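/- Let $G$ be a (finite-dimensional, real, smooth) Lie group, not assumed connected, with Lie algebra $\mathfrak g$, and let $A\in\mathrm{Der}(\mathfrak g)$ be a derivation. A distance $d$ on $G$, not assumed to be related to the topology of $G$, is called $A$-homogeneous if it is left-invariant and there is a continuous multiplicative one-parameter group $(0,\infty)\to\mathrm{Aut}(G)$, $\lambda\mapsto\delta_\lambda$, of Lie group automorphisms (that is, $\delta_{\lambda\mu}=\delta_\lambda\circ\delta_\mu$, and $\lambda\mapsto\delta_\lambda(x)$ is continuous for each $x\in G$) such that for all $\lambda>0$ and $x,y\in G$ $$(\delta_\lambda)_*=\lambda^A:=e^{(\log\lambda)A}\qquad\text{and}\qquad d(\delta_\lambda x,\delta_\lambda y)=\lambda\, d(x,y),$$ where $(\delta_\lambda)_*:\mathfrak g\to\mathfrak g$ denotes the differential of $\delta_\lambda$ at the identity. If $d$ is an $A$-homogeneous distance on $G$, then $d$ induces the manifold topology of $G$, the Lie group $G$ is connected, and every eigenvalue in $\mathbb C$ of (the complexification of) $A$ has strictly positive real part. -/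

import Mathlib

open scoped Manifold ContDiff TensorProduct

noncomputable section

/-- `d` is a distance function on `X` (no topology on `X` is involved). -/
structure IsDistance {X : Type*} (d : X → X → ℝ) : Prop where
  nonneg : ∀ x y, 0 ≤ d x y
  eq_zero_iff : ∀ x y, d x y = 0 ↔ x = y
  symm : ∀ x y, d x y = d y x
  triangle : ∀ x y z, d x z ≤ d x y + d y z

/-- The given topology of `X` is the one whose open sets are the unions of open `d`-balls. -/
def InducesTopology {X : Type*} [TopologicalSpace X] (d : X → X → ℝ) : Prop :=
  ∀ U : Set X, IsOpen U ↔ ∀ x ∈ U, ∃ r : ℝ, 0 < r ∧ ∀ y, d x y < r → y ∈ U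

section LieGroups

variable {n : ℕ} {G : Type*} [TopologicalSpace G] [ChartedSpace (EuclideanSpace ℝ (Fin n)) G]
  [Group G]

/-- Mathlib develops the Lie algebra of a Lie group under this regularity assumption,
which smooth Lie groups satisfy. -/
instance LieGroup.minSmoothness_three [LieGroup (𝓡 n) ∞ G] :
    LieGroup (𝓡 n) (minSmoothness ℝ 3) G := by
  rw [minSmoothness_of_isRCLikeNormedField]
  infer_instance

/-- The automorphism `lam ^ A = exp (log lam • A)` of the Lie algebra of `G`, for a linear
endomorphism `A` of it. The exponential is taken in the Banach algebra of continuous linear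
endomorphisms of `ℝⁿ`, which is the vector space underlying the tangent space of `G` at `1`. -/
def rpowEnd (lam : ℝ) (A : GroupLieAlgebra (𝓡 n) G →ₗ[ℝ] GroupLieAlgebra (𝓡 n) G) :
    GroupLieAlgebra (𝓡 n) G →L[ℝ] GroupLieAlgebra (𝓡 n) G :=
  let B : EuclideanSpace ℝ (Fin n) →ₗ[ℝ] EuclideanSpace ℝ (Fin n) := A
  (NormedSpace.exp (Real.log lam • LinearMap.toContinuousLinearMap B) :
    EuclideanSpace ℝ (Fin n) →L[ℝ] EuclideanSpace ℝ (Fin n))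

/-- The differential at the identity of a group automorphism of `G`, as an endomorphism of the Lie
algebra of `G`. (As `φ 1 = 1`, the tangent space at `φ 1` is the one at `1`.) -/
def differentialAtOne (φ : MulAut G) :
    GroupLieAlgebra (𝓡 n) G →L[ℝ] GroupLieAlgebra (𝓡 n) G :=
  mfderiv (𝓡 n) (𝓡 n) φ (1 : G)

variable [LieGroup (𝓡 n) ∞ G]

/-- `δ` is a multiplicative one-parameter group `(0, ∞) → Aut(G)` of Lie group automorphisms with
`(δ_lam)_* = lam ^ A`. A one-parameter group is a homomorphism (which is built into the type of
`δ`) that is continuous in the parameter. -/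
structure IsOneParameterGroup
    (A : LieDerivation ℝ (GroupLieAlgebra (𝓡 n) G) (GroupLieAlgebra (𝓡 n) G))
    (δ : {r : ℝ // 0 < r} →* MulAut G) : Prop where
  contMDiff : ∀ lam, ContMDiff (𝓡 n) (𝓡 n) ∞ (δ lam)
  continuous_orbit : ∀ x : G, Continuous fun lam => δ lam x
  differential : ∀ lam, differentialAtOne (n := n) (δ lam) = rpowEnd (n := n) (lam : ℝ) A

/-- `d` is an `A`-homogeneous distance on `G`: a left-invariant distance, not assumed to be related
to the topology of `G`, for which the automorphisms `δ_lam` of a one-parameter group with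
`(δ_lam)_* = lam ^ A` are dilations of factor `lam`. -/
structure IsHomogeneousDistance
    (A : LieDerivation ℝ (GroupLieAlgebra (𝓡 n) G) (GroupLieAlgebra (𝓡 n) G))
    (d : G → G → ℝ) : Prop where
  isDistance : IsDistance d
  left_invariant : ∀ g x y, d (g * x) (g * y) = d x y
  exists_dilations : ∃ δ : {r : ℝ // 0 < r} →* MulAut G, IsOneParameterGroup A δ ∧
    ∀ lam x y, d (δ lam x) (δ lam y) = (lam : ℝ) * d x y

end LieGroups

end

/-! Write N(x) = d(1, x), B for A as an endomorphism of ℝⁿ, and D_t = δ_{exp t}, so that N(D_t x) =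
e^t N(x), while in exponential coordinates D_t is exp(tB). The main difficulty is that d is not
known to be compatible with the topology.

N is bounded near 1 (`IsLinearlyDilated.eventually_norm_le`). B is injective, since a kernel vector
would give a point x ≠ 1 fixed by every D_t, whereas N(D_t x) is unbounded in t. Now consider the
products ∏ D_{s_i}(exp(ε b_i)) over the standard basis b_i, with ε fixed and s small. On them N ≤ ∑
e^{s_i} N(exp(ε b_i)). To first order in ε the product is ε ∑ exp(s_i B) b_i, whose derivative in s
at 0 is εB, which is invertible. So for small ε the products fill a neighbourhood of one of them,
and a left translation carries the bound to 1.

The dilations turn boundedness near 1 into continuity of N. An orbit D_t x, t ≤ 0, with N(x) small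
cannot cross the frontier of a relatively compact neighbourhood of 1, because N has a positive
minimum there. Hence the points contracted to 1 form an open subgroup H, on which small N means
close to 1. A compactness argument gives H = G (`IsDilated.mem_contractedSubgroup`); both the
topology and the connectedness of G follow.

If an eigenvalue had real part ≤ 0, some nonzero orbit of exp(tB) would be bounded for t ≥ 0. Scaled
down, it stays in exponential coordinates where N is bounded, contradicting N(D_t x) = e^t N(x). -/

noncomputable section

/-! ### The equation c' = Y(c) v and its dependence on v near v = 0. -/

section LinearInParameterODE

open Set Metric Filter
open scoped NNReal Topology

variable {E : Type*} [NormedAddCommGroup E] [NormedSpace ℝ E]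

/-- Picard-Lindelöf, with the information that the solution stays in the ball on which the vector
field is controlled. -/
theorem IsPicardLindelof.exists_hasDerivWithinAt_mem_closedBall [CompleteSpace E]
    {f : ℝ → E → E} {tmin tmax : ℝ} {t₀ : Icc tmin tmax} {x₀ x : E} {a r L K : ℝ≥0}
    (hf : IsPicardLindelof f t₀ x₀ a r L K) (hx : x ∈ closedBall x₀ r) :
    ∃ α : ℝ → E, α t₀ = x ∧
      (∀ t ∈ Icc tmin tmax, HasDerivWithinAt α (f t (α t)) (Icc tmin tmax) t) ∧
      ∀ t, α t ∈ closedBall x₀ a := by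
  obtain ⟨α, hα⟩ := ODE.FunSpace.exists_isFixedPt_next hf hx
  refine ⟨α.compProj, by rw [ODE.FunSpace.compProj_val, ← hα, ODE.FunSpace.next_apply₀],
    fun t ht ↦ ?_, fun t ↦ α.compProj_mem_closedBall hf.mul_max_le⟩
  apply ODE.hasDerivWithinAt_picard_Icc t₀.2 hf.continuousOn_uncurry
    α.continuous_compProj.continuousOn (fun _ ht' ↦ α.compProj_mem_closedBall hf.mul_max_le)
    x ht |>.congr_of_mem _ ht
  intro t' ht'
  nth_rw 1 [← hα]
  rw [ODE.FunSpace.compProj_of_mem ht', ODE.FunSpace.next_apply]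

/-- `c` is a solution of `c' = Y(c) v`, `c 0 = p`, on `(-2, 2)`, that stays `4 ‖v‖`-close to `p`. -/
structure IsShortSolution (Y : E → E →L[ℝ] E) (p v : E) (c : ℝ → E) : Prop where
  apply_zero : c 0 = p
  hasDerivAt : ∀ t ∈ Ioo (-2 : ℝ) 2, HasDerivAt c (Y (c t) v) t
  mem_closedBall : ∀ t, c t ∈ closedBall p (4 * ‖v‖)

variable {Y : E → E →L[ℝ] E} {p : E} {R : ℝ} {K : ℝ≥0}

theorem exists_isShortSolution [CompleteSpace E] (hK : LipschitzOnWith K Y (closedBall p R))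
    (h2 : ∀ x ∈ closedBall p R, ‖Y x‖ ≤ 2) {v : E} (hv : 4 * ‖v‖ ≤ R) :
    ∃ c, IsShortSolution Y p v c := by
  have hsub : closedBall p (4 * ‖v‖₊ : ℝ≥0) ⊆ closedBall p R := closedBall_subset_closedBall hv
  -- The speed is at most 2‖v‖ and the time at most 2 in either direction, hence the radius 4‖v‖.
  -- Going up to time 2 makes time 1 an interior point.
  have hPL : IsPicardLindelof (fun _ x ↦ Y x v) (tmin := -2) (tmax := 2) ⟨0, by simp⟩ p
      (4 * ‖v‖₊) 0 (2 * ‖v‖₊) (K * ‖v‖₊) := by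
    refine IsPicardLindelof.of_time_independent (fun x hx ↦ ?_) ?_ ?_
    · exact (Y x).le_of_opNorm_le (h2 x (hsub hx)) v
    · refine LipschitzOnWith.of_dist_le_mul fun x hx y hy ↦ ?_
      have h := hK.dist_le_mul x (hsub hx) y (hsub hy)
      rw [dist_eq_norm] at h ⊢
      rw [← sub_apply]
      refine ((Y x - Y y).le_of_opNorm_le h v).trans (le_of_eq ?_)
      push_cast
      ring
    · push_cast
      norm_num
      linarith
  obtain ⟨c, h0, hd, hm⟩ := hPL.exists_hasDerivWithinAt_mem_closedBall
    (x := p) (mem_closedBall_self le_rfl)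
  exact ⟨c, h0, fun t ht ↦ (hd t (Ioo_subset_Icc_self ht)).hasDerivAt (Icc_mem_nhds ht.1 ht.2),
    fun t ↦ by simpa using hm t⟩

/-- The basic estimate on the dependence on the parameter `v` of the equation `c' = Y(c) v`. -/
theorem IsShortSolution.norm_sub_sub_le (hK : LipschitzOnWith K Y (closedBall p R))
    (h2 : ∀ x ∈ closedBall p R, ‖Y x‖ ≤ 2) (hp : Y p = ContinuousLinearMap.id ℝ E)
    {ρ : ℝ} (hρR : 4 * ρ ≤ R) (hρK : K * ρ ≤ 1 / 2) {u v : E} {c d : ℝ → E}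
    (hc : IsShortSolution Y p u c) (hd : IsShortSolution Y p v d) (hu : ‖u‖ ≤ ρ) (hv : ‖v‖ ≤ ρ) :
    ‖c 1 - d 1 - (u - v)‖ ≤ 8 * K * ρ * ‖u - v‖ := by
  have hρ : 0 ≤ ρ := (norm_nonneg u).trans hu
  have hcR t : c t ∈ closedBall p R :=
    closedBall_subset_closedBall (by linarith) (hc.mem_closedBall t)
  have hdR t : d t ∈ closedBall p R :=
    closedBall_subset_closedBall (by linarith) (hd.mem_closedBall t)
  have hpR : p ∈ closedBall p R := mem_closedBall_self (by linarith)
  have hI : Icc (0 : ℝ) 1 ⊆ Ioo (-2) 2 := fun t ht ↦ ⟨by linarith [ht.1], by linarith [ht.2]⟩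
  have hder (t) (ht : t ∈ Icc (0 : ℝ) 1) :
      HasDerivAt (fun t ↦ c t - d t) (Y (c t) u - Y (d t) v) t :=
    (hc.hasDerivAt t (hI ht)).sub (hd.hasDerivAt t (hI ht))
  obtain ⟨τ, hτ, hmax⟩ := isCompact_Icc.exists_isMaxOn (nonempty_Icc.2 zero_le_one)
    (f := fun t ↦ ‖c t - d t‖)
    (fun t ht ↦ (hder t ht).continuousAt.norm.continuousWithinAt)
  set D := ‖c τ - d τ‖ with hD
  have hYY (t) (ht : t ∈ Icc (0 : ℝ) 1) : ‖(Y (c t) - Y (d t)) u‖ ≤ K * D * ρ := by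
    have h1 := hK.norm_sub_le (hcR t) (hdR t)
    have h3 : ‖c t - d t‖ ≤ D := hmax ht
    calc ‖(Y (c t) - Y (d t)) u‖ ≤ ‖Y (c t) - Y (d t)‖ * ‖u‖ := ContinuousLinearMap.le_opNorm _ _
      _ ≤ (K * D) * ρ := by gcongr; exact h1.trans (by gcongr)
  -- The mean value inequality gives D ≤ KρD + 2‖u - v‖; since Kρ ≤ 1/2, the first term is absorbed
  -- on the left.
  have hD4 : D ≤ 4 * ‖u - v‖ := by
    have h := (convex_Icc (0 : ℝ) 1).norm_image_sub_le_of_norm_hasDerivWithin_le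
      (C := K * D * ρ + 2 * ‖u - v‖) (fun t ht ↦ (hder t ht).hasDerivWithinAt) (fun t ht ↦ ?_)
      (left_mem_Icc.2 zero_le_one) hτ
    · rw [hc.apply_zero, hd.apply_zero, sub_self, sub_zero, sub_zero, Real.norm_eq_abs,
        abs_of_nonneg hτ.1] at h
      have h3 : (K * D * ρ + 2 * ‖u - v‖) * τ ≤ (K * D * ρ + 2 * ‖u - v‖) * 1 := by
        gcongr; exact hτ.2
      have h4 : K * ρ * D ≤ 1 / 2 * D := by gcongr
      rw [← hD] at h
      linarith
    · have : Y (c t) u - Y (d t) v = (Y (c t) - Y (d t)) u + Y (d t) (u - v) := by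
        simp
      rw [this]
      exact (norm_add_le _ _).trans
        (add_le_add (hYY t ht) ((Y (d t)).le_of_opNorm_le (h2 _ (hdR t)) _))
  -- The derivative of c - d - t(u - v) splits into a term with Y(c) - Y(d) and one with Y(d) - Y(p)
  -- = Y(d) - id. Each is at most 4Kρ‖u - v‖.
  have h := (convex_Icc (0 : ℝ) 1).norm_image_sub_le_of_norm_hasDerivWithin_le
    (f := fun t ↦ c t - d t - t • (u - v)) (C := 8 * K * ρ * ‖u - v‖)
    (f' := fun t ↦ Y (c t) u - Y (d t) v - (u - v))
    (fun t ht ↦ ((hder t ht).sub (by simpa using (hasDerivAt_id t).smul_const (u - v)))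
      |>.hasDerivWithinAt) (fun t ht ↦ ?_)
    (left_mem_Icc.2 zero_le_one) (right_mem_Icc.2 zero_le_one)
  · simpa [hc.apply_zero, hd.apply_zero] using h
  · have : Y (c t) u - Y (d t) v - (u - v)
        = (Y (c t) - Y (d t)) u + (Y (d t) - Y p) (u - v) := by
      simp [hp]
      abel
    have h5 : ‖(Y (d t) - Y p) (u - v)‖ ≤ (K * (4 * ρ)) * ‖u - v‖ := by
      refine ContinuousLinearMap.le_of_opNorm_le _ ((hK.norm_sub_le (hdR t) hpR).trans ?_) _
      have := mem_closedBall_iff_norm.1 (hd.mem_closedBall t)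
      gcongr
      linarith
    rw [this]
    refine (norm_add_le _ _).trans ((add_le_add (hYY t ht) h5).trans ?_)
    have : K * D * ρ ≤ K * (4 * ‖u - v‖) * ρ := by gcongr
    linarith

/-- The factor 8Kρ of the basic estimate tends to 0 with ρ, which is exactly strict
differentiability with derivative the identity. This will make the exponential map a local
coordinate. -/
theorem hasStrictFDerivAt_isShortSolution (hR : 0 < R)
    (hK : LipschitzOnWith K Y (closedBall p R))
    (h2 : ∀ x ∈ closedBall p R, ‖Y x‖ ≤ 2) (hp : Y p = ContinuousLinearMap.id ℝ E)
    {c : E → ℝ → E} (hc : ∀ v, 4 * ‖v‖ ≤ R → IsShortSolution Y p v (c v)) :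
    HasStrictFDerivAt (fun v ↦ c v 1) (ContinuousLinearMap.id ℝ E) 0 := by
  refine .of_isLittleO (Asymptotics.isLittleO_iff.2 fun ε hε ↦ ?_)
  obtain ⟨ρ, hρ, hρR, hρK, hρε⟩ :
      ∃ ρ : ℝ, 0 < ρ ∧ 4 * ρ ≤ R ∧ K * ρ ≤ 1 / 2 ∧ 8 * K * ρ ≤ ε := by
    have h1 : Tendsto (fun ρ : ℝ ↦ 4 * ρ) (𝓝[>] 0) (𝓝 (4 * 0)) :=
      ((continuous_const.mul continuous_id).tendsto 0).mono_left nhdsWithin_le_nhds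
    have h2 : Tendsto (fun ρ : ℝ ↦ K * ρ) (𝓝[>] 0) (𝓝 (K * 0)) :=
      ((continuous_const.mul continuous_id).tendsto 0).mono_left nhdsWithin_le_nhds
    have h3 : Tendsto (fun ρ : ℝ ↦ 8 * K * ρ) (𝓝[>] 0) (𝓝 (8 * K * 0)) :=
      ((continuous_const.mul continuous_id).tendsto 0).mono_left nhdsWithin_le_nhds
    have h0 : ∀ᶠ ρ : ℝ in 𝓝[>] 0, 0 < ρ := self_mem_nhdsWithin
    obtain ⟨ρ, h⟩ := (h0.and
      ((h1.eventually_le_const (u := R) (by simpa)).and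
      ((h2.eventually_le_const (u := 1 / 2) (by simp)).and
      (h3.eventually_le_const (u := ε) (by simpa))))).exists
    exact ⟨ρ, h⟩
  have : closedBall (0 : E) ρ ×ˢ closedBall (0 : E) ρ ∈ 𝓝 ((0 : E), (0 : E)) :=
    prod_mem_nhds (closedBall_mem_nhds _ hρ) (closedBall_mem_nhds _ hρ)
  filter_upwards [this] with ⟨u, v⟩ ⟨hu, hv⟩
  rw [mem_closedBall_zero_iff] at hu hv
  refine ((hc u (by linarith)).norm_sub_sub_le hK h2 hp hρR hρK (hc v (by linarith)) hu hv).trans ?_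
  gcongr

end LinearInParameterODE

/-! ### Topology and connectedness from a dilated distance bounded near 1. -/

section HomogeneousNorm

open Set Filter
open scoped Topology Pointwise

theorem IsPreconnected.inter_frontier_nonempty {X : Type*} [TopologicalSpace X] {S W : Set X}
    (hS : IsPreconnected S) (h1 : (S ∩ W).Nonempty) (h2 : (S ∩ Wᶜ).Nonempty) :
    (S ∩ frontier W).Nonempty := by
  by_contra h
  rw [not_nonempty_iff_eq_empty, ← disjoint_iff_inter_eq_empty] at h
  obtain ⟨x, hxS, hxW⟩ := h1
  obtain ⟨y, hyS, hyW⟩ := h2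
  have hcov : S ⊆ interior W ∪ (closure W)ᶜ := fun z hz ↦ by
    by_contra hz'
    simp only [mem_union, mem_compl_iff, not_or, not_not] at hz'
    exact h.le_bot ⟨hz, hz'.2, hz'.1⟩
  have hx : x ∈ interior W := (hcov hxS).resolve_right fun h' ↦ h' (subset_closure hxW)
  have hy : y ∈ (closure W)ᶜ := (hcov hyS).resolve_left fun h' ↦ hyW (interior_subset h')
  obtain ⟨z, -, hz1, hz2⟩ := hS _ _ isOpen_interior isClosed_closure.isOpen_compl hcov
    ⟨x, hxS, hx⟩ ⟨y, hyS, hy⟩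
  exact hz2 (subset_closure (interior_subset hz1))

/-- A left-invariant distance `d` on a topological group together with a family `D` of continuous
dilations, `D t` being of factor `exp t`, such that `d` is bounded near the identity. -/
structure IsDilated {G : Type*} [TopologicalSpace G] [Group G] (d : G → G → ℝ) (D : ℝ → G →* G) :
    Prop where
  isDistance : IsDistance d
  left_invariant : ∀ g x y, d (g * x) (g * y) = d x y
  apply_zero : ∀ x, D 0 x = x
  continuous_map : ∀ t, Continuous (D t)
  continuous_orbit : ∀ x, Continuous fun t ↦ D t x
  dilation : ∀ t x y, d (D t x) (D t y) = Real.exp t * d x y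
  bounded : ∃ C, ∀ᶠ x in 𝓝 1, d 1 x ≤ C

namespace IsDilated

variable {G : Type*} [TopologicalSpace G] [Group G] {d : G → G → ℝ} {D : ℝ → G →* G}

theorem dist_eq (h : IsDilated d D) (x y : G) : d x y = d 1 (x⁻¹ * y) := by
  rw [← h.left_invariant x⁻¹ x y, inv_mul_cancel]

theorem norm_map (h : IsDilated d D) (t : ℝ) (x : G) : d 1 (D t x) = Real.exp t * d 1 x := by
  rw [← h.dilation, map_one]

theorem norm_map_le (h : IsDilated d D) {t : ℝ} (ht : t ≤ 0) (x : G) : d 1 (D t x) ≤ d 1 x := by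
  rw [h.norm_map]
  exact mul_le_of_le_one_left (h.isDistance.nonneg _ _) (Real.exp_le_one_iff.2 ht)

theorem norm_pos (h : IsDilated d D) {x : G} (hx : x ≠ 1) : 0 < d 1 x :=
  (h.isDistance.nonneg _ _).lt_of_ne fun h0 ↦ hx ((h.isDistance.eq_zero_iff _ _).1 h0.symm).symm

theorem tendsto_norm_map (h : IsDilated d D) (x : G) :
    Tendsto (fun t ↦ d 1 (D t x)) atBot (𝓝 0) := by
  simp only [h.norm_map]
  simpa using Real.tendsto_exp_atBot.mul_const (d 1 x)

/-- If D_{-t} x lies where N ≤ C, then N(x) = e^t N(D_{-t} x) ≤ e^t C, and t can be chosen very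
negative. -/
theorem eventually_norm_lt (h : IsDilated d D) {ε : ℝ} (hε : 0 < ε) : ∀ᶠ x in 𝓝 1, d 1 x < ε := by
  obtain ⟨C, hC⟩ := h.bounded
  obtain ⟨t, ht⟩ : ∃ t, Real.exp t * C < ε := by
    have : Tendsto (fun t ↦ Real.exp t * C) atBot (𝓝 (0 * C)) :=
      Real.tendsto_exp_atBot.mul_const C
    exact (this.eventually_lt_const (by simpa)).exists
  have hc : Tendsto (D (-t)) (𝓝 1) (𝓝 1) := by
    simpa using (h.continuous_map (-t)).tendsto 1
  filter_upwards [hc.eventually hC] with x hx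
  rw [h.norm_map] at hx
  calc d 1 x = Real.exp t * (Real.exp (-t) * d 1 x) := by
        rw [← mul_assoc, ← Real.exp_add]; simp
    _ ≤ Real.exp t * C := by gcongr
    _ < ε := ht

variable [IsTopologicalGroup G]

theorem continuous_norm (h : IsDilated d D) : Continuous fun x ↦ d 1 x := by
  refine continuous_iff_continuousAt.2 fun x ↦ Metric.tendsto_nhds.2 fun ε hε ↦ ?_
  have hc : Tendsto (fun y ↦ x⁻¹ * y) (𝓝 x) (𝓝 1) := by
    simpa using (continuous_const_mul x⁻¹).tendsto x
  filter_upwards [hc.eventually (h.eventually_norm_lt hε)] with y hy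
  rw [← h.dist_eq] at hy
  have h1 := h.isDistance.triangle 1 x y
  have h2 := h.isDistance.triangle 1 y x
  rw [h.isDistance.symm y x] at h2
  rw [Real.dist_eq, abs_lt]
  constructor <;> linarith

theorem exists_pos_forall_le_norm (h : IsDilated d D) {K : Set G} (hK : IsCompact K)
    (h1 : (1 : G) ∉ K) : ∃ c > 0, ∀ x ∈ K, c ≤ d 1 x := by
  rcases K.eq_empty_or_nonempty with rfl | hne
  · exact ⟨1, one_pos, by simp⟩
  obtain ⟨x, hx, hmin⟩ := hK.exists_isMinOn hne h.continuous_norm.continuousOn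
  exact ⟨d 1 x, h.norm_pos (fun h' ↦ h1 (h' ▸ hx)), fun y hy ↦ hmin hy⟩

/-- Orbits of points of small norm cannot cross the boundary of `W`. -/
theorem exists_forall_mem_iff (h : IsDilated d D) {W : Set G} (hW : IsOpen W) (h1 : 1 ∈ W)
    (hc : IsCompact (closure W)) :
    ∃ c > 0, ∀ x, d 1 x < c → ∀ t ≤ 0, (D t x ∈ W ↔ x ∈ W) := by
  obtain ⟨c, hc0, hc⟩ := h.exists_pos_forall_le_norm
    (hc.of_isClosed_subset isClosed_frontier frontier_subset_closure)
    (fun h' ↦ by rw [hW.frontier_eq] at h'; exact h'.2 h1)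
  refine ⟨c, hc0, fun x hx t ht ↦ ?_⟩
  by_contra hne
  have hS : IsPreconnected ((fun s ↦ D s x) '' Icc t 0) :=
    isPreconnected_Icc.image _ (h.continuous_orbit x).continuousOn
  have ht' : D t x ∈ (fun s ↦ D s x) '' Icc t 0 := ⟨t, left_mem_Icc.2 ht, rfl⟩
  have hx' : x ∈ (fun s ↦ D s x) '' Icc t 0 := ⟨0, right_mem_Icc.2 ht, h.apply_zero x⟩
  have : ((fun s ↦ D s x) '' Icc t 0 ∩ frontier W).Nonempty := by
    by_cases hxW : x ∈ W
    · exact hS.inter_frontier_nonempty ⟨x, hx', hxW⟩ ⟨_, ht', fun h' ↦ hne (by simp [h', hxW])⟩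
    · exact hS.inter_frontier_nonempty ⟨_, ht', by_contra fun h' ↦ hne (by simp [h', hxW])⟩
        ⟨x, hx', hxW⟩
  obtain ⟨_, ⟨s, hs, rfl⟩, hsW⟩ := this
  exact (((hc _ hsW).trans (h.norm_map_le hs.2 x)).trans_lt hx).false

/-- The subgroup of the points that the dilations contract to the identity. -/
def contractedSubgroup (D : ℝ → G →* G) : Subgroup G where
  carrier := {x | Tendsto (fun t ↦ D t x) atBot (𝓝 1)}
  one_mem' := by simpa using tendsto_const_nhds
  mul_mem' {x y} hx hy := by simpa using Tendsto.mul hx hy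
  inv_mem' {x} hx := by simpa using Tendsto.inv hx

theorem mem_contractedSubgroup_iff {D : ℝ → G →* G} {x : G} :
    x ∈ contractedSubgroup D ↔ Tendsto (fun t ↦ D t x) atBot (𝓝 1) := Iff.rfl

theorem exists_isOpen_subset [LocallyCompactSpace G] (U : Set G) (hU : U ∈ 𝓝 1) :
    ∃ W ⊆ U, IsOpen W ∧ (1 : G) ∈ W ∧ IsCompact (closure W) := by
  obtain ⟨K, hK, h1, h2⟩ := exists_compact_subset isOpen_interior (mem_interior_iff_mem_nhds.2 hU)
  exact ⟨interior K, interior_subset.trans (h2.trans interior_subset), isOpen_interior, h1,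
    hK.closure_of_subset interior_subset⟩

/-- A point of W with small norm has its backward orbit trapped in W. The norm tends to 0 along it,
but is bounded below on the compact set closure W \ V for each open V containing 1, so the orbit
enters V. -/
theorem isOpen_contractedSubgroup [LocallyCompactSpace G] (h : IsDilated d D) :
    IsOpen (contractedSubgroup D : Set G) := by
  obtain ⟨W, -, hW, h1, hWc⟩ := exists_isOpen_subset (univ : Set G) univ_mem
  obtain ⟨c, hc0, hc⟩ := h.exists_forall_mem_iff hW h1 hWc
  refine (contractedSubgroup D).isOpen_of_mem_nhds (g := 1) ?_
  filter_upwards [hW.mem_nhds h1, h.eventually_norm_lt hc0] with x hxW hxc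
  refine mem_contractedSubgroup_iff.2 (tendsto_nhds.2 fun V hV hV1 ↦ ?_)
  obtain ⟨c', hc'0, hc'⟩ := h.exists_pos_forall_le_norm (hWc.diff hV) (fun h' ↦ h'.2 hV1)
  filter_upwards [(h.tendsto_norm_map x).eventually_lt_const hc'0, eventually_le_atBot 0]
    with t ht ht0
  by_contra htV
  exact ((hc' _ ⟨subset_closure ((hc x hxc t ht0).2 hxW), htV⟩).trans_lt ht).false

/-- The backward orbit of a contracted point ends in W and, when the norm is small, cannot have
crossed the frontier of W, so it started in W. -/
theorem exists_forall_mem_of_norm_lt (h : IsDilated d D) {W : Set G} (hW : IsOpen W) (h1 : 1 ∈ W)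
    (hWc : IsCompact (closure W)) : ∃ c > 0, ∀ x ∈ contractedSubgroup D, d 1 x < c → x ∈ W := by
  obtain ⟨c, hc0, hc⟩ := h.exists_forall_mem_iff hW h1 hWc
  refine ⟨c, hc0, fun x hx hxc ↦ ?_⟩
  obtain ⟨t, htW, ht0⟩ := ((mem_contractedSubgroup_iff.1 hx).eventually (hW.mem_nhds h1)
    |>.and (eventually_le_atBot 0)).exists
  exact (hc x hxc t ht0).1 htW

variable [LocallyCompactSpace G]

/-- An open subgroup is also closed, and the path t ↦ D_t x x⁻¹ passes through 1 at t = 0; the line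
is connected. -/
theorem map_mul_inv_mem_contractedSubgroup (h : IsDilated d D) (x : G) (t : ℝ) :
    D t x * x⁻¹ ∈ contractedSubgroup D := by
  have hcont : Continuous fun t ↦ D t x * x⁻¹ := (h.continuous_orbit x).mul continuous_const
  have hclopen : IsClopen ((fun t ↦ D t x * x⁻¹) ⁻¹' (contractedSubgroup D : Set G)) :=
    ⟨((contractedSubgroup D).isClosed_of_isOpen h.isOpen_contractedSubgroup).preimage hcont,
      h.isOpen_contractedSubgroup.preimage hcont⟩
  have := hclopen.eq_univ ⟨0, by simp [h.apply_zero, (contractedSubgroup D).one_mem]⟩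
  exact this.ge (mem_univ t)

/-- The points k_t = x (D_t x)⁻¹ lie in the contracted subgroup and d(k_t, x) = N(D_t x) → 0 as t →
-∞. Convergence for d alone says nothing yet about the topology, so a cluster point is extracted
inside the subgroup and identified with x. -/
theorem mem_contractedSubgroup (h : IsDilated d D) (x : G) : x ∈ contractedSubgroup D := by
  obtain ⟨W, -, hW, h1, hWc⟩ := exists_isOpen_subset (univ : Set G) univ_mem
  obtain ⟨c, hc0, hc⟩ := h.exists_forall_mem_of_norm_lt hW h1 hWc
  set k : ℝ → G := fun t ↦ (D t x * x⁻¹)⁻¹ with hk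
  have hkH t : k t ∈ contractedSubgroup D :=
    (contractedSubgroup D).inv_mem (h.map_mul_inv_mem_contractedSubgroup x t)
  have hkx t : d (k t) x = d 1 (D t x) := by
    rw [h.dist_eq]
    simp [hk]
  have hlim : Tendsto (fun t ↦ d (k t) x) atBot (𝓝 0) := by
    simpa only [hkx] using h.tendsto_norm_map x
  have hsmall := hlim.eventually_lt_const (half_pos hc0)
  obtain ⟨t₀, ht₀⟩ := hsmall.exists
  -- By the triangle inequality through x, k_{t₀}⁻¹ k_t has norm below c. It lies in the subgroup,
  -- where small norm forces membership in W.
  have hmem : ∀ᶠ t in atBot, k t ∈ (k t₀ * ·) '' closure W := by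
    filter_upwards [hsmall] with t ht
    refine ⟨(k t₀)⁻¹ * k t, subset_closure (hc _ ?_ ?_), by simp⟩
    · exact (contractedSubgroup D).mul_mem ((contractedSubgroup D).inv_mem (hkH _)) (hkH _)
    · rw [← h.dist_eq]
      have := h.isDistance.triangle (k t₀) x (k t)
      rw [h.isDistance.symm x] at this
      linarith
  obtain ⟨y, -, hy⟩ := (hWc.image (continuous_const_mul (k t₀))).exists_mapClusterPt_of_frequently
    hmem.frequently
  have hdc : Continuous fun z ↦ d z x := by
    simp only [h.dist_eq _ x]
    exact h.continuous_norm.comp (continuous_inv.mul continuous_const)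
  have hyx : y = x := by
    have h1 : MapClusterPt (d y x) atBot (fun t ↦ d (k t) x) :=
      hy.continuousAt_comp (f := fun z ↦ d z x) hdc.continuousAt
    have h2 : d y x = 0 := by
      have : (𝓝 (d y x) ⊓ 𝓝 0).NeBot := h1.neBot.mono (inf_le_inf_left _ hlim)
      exact eq_of_nhds_neBot this
    exact (h.isDistance.eq_zero_iff _ _).1 h2
  rw [← hyx]
  have hcl : IsClosed (contractedSubgroup D : Set G) :=
    (contractedSubgroup D).isClosed_of_isOpen h.isOpen_contractedSubgroup
  exact hcl.mem_of_mapClusterPt hy (Eventually.of_forall hkH)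

theorem inducesTopology (h : IsDilated d D) : InducesTopology d := by
  intro U
  constructor
  · intro hU x hx
    have hV : (x * ·) ⁻¹' U ∈ 𝓝 (1 : G) :=
      (hU.preimage (continuous_const_mul x)).mem_nhds (by simpa)
    obtain ⟨W, hWU, hW, h1, hWc⟩ := exists_isOpen_subset _ hV
    obtain ⟨c, hc0, hc⟩ := h.exists_forall_mem_of_norm_lt hW h1 hWc
    refine ⟨c, hc0, fun y hy ↦ ?_⟩
    rw [h.dist_eq] at hy
    simpa using hWU (hc _ (h.mem_contractedSubgroup _) hy)
  · intro hU
    refine isOpen_iff_mem_nhds.2 fun x hx ↦ ?_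
    obtain ⟨r, hr, hrU⟩ := hU x hx
    have hc : Tendsto (fun y ↦ x⁻¹ * y) (𝓝 x) (𝓝 1) := by
      simpa using (continuous_const_mul x⁻¹).tendsto x
    filter_upwards [hc.eventually (h.eventually_norm_lt hr)] with y hy
    exact hrU y (by rwa [h.dist_eq])

/-- Every orbit is connected, contains its point at t = 0, and has 1 in its closure. -/
theorem connectedSpace (h : IsDilated d D) : ConnectedSpace G := by
  refine connectedSpace_iff_connectedComponent.2 ⟨1, eq_univ_of_forall fun x ↦ ?_⟩
  have hS : IsPreconnected (range fun t ↦ D t x) :=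
    isPreconnected_range (h.continuous_orbit x)
  have h1 : (1 : G) ∈ closure (range fun t ↦ D t x) :=
    mem_closure_of_tendsto (mem_contractedSubgroup_iff.1 (h.mem_contractedSubgroup x))
      (Eventually.of_forall fun t ↦ mem_range_self t)
  exact hS.closure.subset_connectedComponent h1 (subset_closure ⟨0, h.apply_zero x⟩)

end IsDilated

end HomogeneousNorm

/-! ### Multiplication and left-invariant fields in the chart at 1. -/

section LocalExponential

open Set Filter
open scoped Topology NNReal

variable {n : ℕ} {G : Type*} [TopologicalSpace G] [ChartedSpace (EuclideanSpace ℝ (Fin n)) G]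

/-- Inseparable points lie in a common chart domain, where the chart distinguishes them. For a
topological group T0 implies Hausdorff, which uniqueness of integral curves requires. -/
theorem ChartedSpace.t0Space (H : Type*) [TopologicalSpace H] [T0Space H] (X : Type*)
    [TopologicalSpace X] [ChartedSpace H X] : T0Space X := by
  refine ⟨fun x y hxy ↦ ?_⟩
  have hx := mem_chart_source H x
  have hy : y ∈ (chartAt H x).source := (hxy.mem_open_iff (chartAt H x).open_source).1 hx
  refine (chartAt H x).injOn hx hy (Inseparable.eq ?_)
  rw [inseparable_iff_specializes_and] at hxy ⊢
  refine ⟨?_, ?_⟩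
  · exact hxy.1.map_of_continuousWithinAt ((chartAt H x).continuousOn y hy) hx
  · exact hxy.2.map_of_continuousWithinAt ((chartAt H x).continuousOn x hx) hy

variable [Group G]

variable (n G) in
/-- The multiplication of `G` read in the chart at `1`. -/
def chartMul (x y : EuclideanSpace ℝ (Fin n)) : EuclideanSpace ℝ (Fin n) :=
  extChartAt (𝓡 n) (1 : G) ((extChartAt (𝓡 n) (1 : G)).symm x * (extChartAt (𝓡 n) (1 : G)).symm y)

theorem chartMul_one_left {y : EuclideanSpace ℝ (Fin n)}
    (hy : y ∈ (extChartAt (𝓡 n) (1 : G)).target) :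
    chartMul n G (extChartAt (𝓡 n) (1 : G) 1) y = y := by
  rw [chartMul, extChartAt_to_inv, one_mul, PartialEquiv.right_inv _ hy]

theorem chartMul_one_right {y : EuclideanSpace ℝ (Fin n)}
    (hy : y ∈ (extChartAt (𝓡 n) (1 : G)).target) :
    chartMul n G y (extChartAt (𝓡 n) (1 : G) 1) = y := by
  rw [chartMul, extChartAt_to_inv, mul_one, PartialEquiv.right_inv _ hy]

theorem chartMul_one_left_eventuallyEq :
    chartMul n G (extChartAt (𝓡 n) (1 : G) 1) =ᶠ[𝓝 (extChartAt (𝓡 n) (1 : G) 1)] id := by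
  filter_upwards [extChartAt_target_mem_nhds (I := 𝓡 n) (1 : G)] with y hy
  exact chartMul_one_left hy

theorem chartMul_one_right_eventuallyEq :
    (fun y ↦ chartMul n G y (extChartAt (𝓡 n) (1 : G) 1))
      =ᶠ[𝓝 (extChartAt (𝓡 n) (1 : G) 1)] id := by
  filter_upwards [extChartAt_target_mem_nhds (I := 𝓡 n) (1 : G)] with y hy
  exact chartMul_one_right hy

variable (n G) in
/-- The left-invariant vector fields of `G` read in the chart at `1`. -/
def chartInvariantField (x : EuclideanSpace ℝ (Fin n)) :
    EuclideanSpace ℝ (Fin n) →L[ℝ] EuclideanSpace ℝ (Fin n) :=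
  fderiv ℝ (chartMul n G x) (extChartAt (𝓡 n) (1 : G) 1)

theorem chartInvariantField_one :
    chartInvariantField n G (extChartAt (𝓡 n) (1 : G) 1) = ContinuousLinearMap.id ℝ _ := by
  rw [chartInvariantField, chartMul_one_left_eventuallyEq.fderiv_eq, fderiv_id]

variable [LieGroup (𝓡 n) ∞ G]

theorem contDiffAt_chartMul : ContDiffAt ℝ ∞ (Function.uncurry (chartMul n G))
    (extChartAt (𝓡 n) (1 : G) 1, extChartAt (𝓡 n) (1 : G) 1) := by
  rw [← contMDiffAt_iff_contDiffAt]
  have hs : ContMDiffAt (𝓡 n) (𝓡 n) ∞ (extChartAt (𝓡 n) (1 : G)).symm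
      (extChartAt (𝓡 n) (1 : G) 1) :=
    (contMDiffOn_extChartAt_symm (1 : G)).contMDiffAt (extChartAt_target_mem_nhds (1 : G))
  have h1 := ContMDiffAt.comp
    ((extChartAt (𝓡 n) (1 : G) 1, extChartAt (𝓡 n) (1 : G) 1) :
      EuclideanSpace ℝ (Fin n) × EuclideanSpace ℝ (Fin n)) hs contDiffAt_fst.contMDiffAt
  have h2 := ContMDiffAt.comp
    ((extChartAt (𝓡 n) (1 : G) 1, extChartAt (𝓡 n) (1 : G) 1) :
      EuclideanSpace ℝ (Fin n) × EuclideanSpace ℝ (Fin n)) hs contDiffAt_snd.contMDiffAt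
  refine ContMDiffAt.comp (I' := 𝓡 n) _ ?_ (h1.mul h2)
  simp only [extChartAt_to_inv, mul_one]
  exact contMDiffAt_extChartAt

theorem contDiffAt_chartInvariantField :
    ContDiffAt ℝ 1 (chartInvariantField n G) (extChartAt (𝓡 n) (1 : G) 1) :=
  ContDiffAt.fderiv (f := chartMul n G) (g := fun _ ↦ extChartAt (𝓡 n) (1 : G) 1) (n := ∞)
    contDiffAt_chartMul contDiffAt_const (by norm_cast)

/-- The multiplication of `G` in the chart at `1` is infinitesimally the addition. -/
theorem hasStrictFDerivAt_chartMul : HasStrictFDerivAt (Function.uncurry (chartMul n G))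
    (ContinuousLinearMap.fst ℝ _ _ + ContinuousLinearMap.snd ℝ _ _)
    (extChartAt (𝓡 n) (1 : G) 1, extChartAt (𝓡 n) (1 : G) 1) := by
  have h := (contDiffAt_chartMul (n := n) (G := G)).hasStrictFDerivAt (by simp)
  set p := extChartAt (𝓡 n) (1 : G) 1
  set L := fderiv ℝ (Function.uncurry (chartMul n G)) (p, p)
  have h1 : L ∘L ContinuousLinearMap.inl ℝ _ _ = ContinuousLinearMap.id ℝ _ :=
    (HasFDerivAt.comp (g := Function.uncurry (chartMul n G)) (f := fun y ↦ (y, p)) p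
      h.hasFDerivAt (hasFDerivAt_prodMk_left p p)).unique
      ((hasFDerivAt_id p).congr_of_eventuallyEq chartMul_one_right_eventuallyEq)
  have h2 : L ∘L ContinuousLinearMap.inr ℝ _ _ = ContinuousLinearMap.id ℝ _ :=
    (HasFDerivAt.comp (g := Function.uncurry (chartMul n G)) p h.hasFDerivAt
      (hasFDerivAt_prodMk_right p p)).unique
      ((hasFDerivAt_id p).congr_of_eventuallyEq chartMul_one_left_eventuallyEq)
  have hL : L = ContinuousLinearMap.fst ℝ _ _ + ContinuousLinearMap.snd ℝ _ _ := by
    refine ContinuousLinearMap.ext fun z ↦ ?_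
    have h3 : L (z.1, 0) = z.1 := congr($h1 z.1)
    have h4 : L (0, z.2) = z.2 := congr($h2 z.2)
    calc L z = L (z.1, 0) + L (0, z.2) := by rw [← map_add]; simp
      _ = z.1 + z.2 := by rw [h3, h4]
  rwa [hL] at h

theorem mdifferentiableAt_extChartAt_symm {x : EuclideanSpace ℝ (Fin n)} {g : G}
    (hx : x ∈ (extChartAt (𝓡 n) g).target) :
    MDifferentiableAt (𝓡 n) (𝓡 n) (extChartAt (𝓡 n) g).symm x :=
  ((contMDiffOn_extChartAt_symm (n := ∞) g).contMDiffAt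
    ((isOpen_extChartAt_target g).mem_nhds hx)).mdifferentiableAt (by simp)

/-- Differentiate ψ(x · y) = ψ(x) ψ(y) in y at the image of 1, where ψ is the inverse chart and x ·
y is `chartMul`. The derivative of ψ there is the identity, because the tangent space at 1 is
trivialised by this very chart. -/
theorem mfderiv_extChartAt_symm_chartInvariantField {x : EuclideanSpace ℝ (Fin n)}
    (hx : x ∈ (extChartAt (𝓡 n) (1 : G)).target) (v : EuclideanSpace ℝ (Fin n)) :
    mfderiv (𝓡 n) (𝓡 n) (extChartAt (𝓡 n) (1 : G)).symm x (chartInvariantField n G x v) =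
      mulInvariantVectorField (I := 𝓡 n) (G := G) v ((extChartAt (𝓡 n) (1 : G)).symm x) := by
  set p := extChartAt (𝓡 n) (1 : G) 1 with hp
  set ψ := (extChartAt (𝓡 n) (1 : G)).symm with hψ
  have hpt : p ∈ (extChartAt (𝓡 n) (1 : G)).target := mem_extChartAt_target 1
  have hψp : ψ p = 1 := extChartAt_to_inv 1
  have hgx : ψ x ∈ (extChartAt (𝓡 n) (1 : G)).source := PartialEquiv.map_target _ hx
  have hL : HasMFDerivAt (𝓡 n) (𝓡 n) (fun y ↦ ψ x * y) (ψ p)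
      (mfderiv (𝓡 n) (𝓡 n) (fun y ↦ ψ x * y) (1 : G)) := by
    rw [hψp]
    exact ((contMDiff_mul_left (n := ∞)).mdifferentiable (by simp) 1).hasMFDerivAt
  have hψ' : HasMFDerivAt (𝓡 n) (𝓡 n) ψ p
      (ContinuousLinearMap.id ℝ (EuclideanSpace ℝ (Fin n))) := by
    have h := mfderivWithin_range_extChartAt_symm (I := 𝓡 n) (x := (1 : G))
    rw [ModelWithCorners.range_eq_univ, mfderivWithin_univ] at h
    have h2 := (mdifferentiableAt_extChartAt_symm hpt).hasMFDerivAt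
    rw [h] at h2
    exact h2
  have h1 := HasMFDerivAt.comp p hL hψ'
  have hcm : DifferentiableAt ℝ (chartMul n G x) p := by
    rw [← mdifferentiableAt_iff_differentiableAt]
    refine MDifferentiableAt.comp (I' := 𝓡 n) p ?_ h1.mdifferentiableAt
    rw [← hψ, hψp, mul_one]
    exact mdifferentiableAt_extChartAt (by rwa [extChartAt_source] at hgx)
  have hψx : ∀ y, y = x → HasMFDerivAt (𝓡 n) (𝓡 n) ψ y (mfderiv (𝓡 n) (𝓡 n) ψ x) := by
    rintro _ rfl
    exact (mdifferentiableAt_extChartAt_symm hx).hasMFDerivAt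
  have h2 := HasMFDerivAt.comp p (hψx _ (chartMul_one_right hx)) hcm.hasFDerivAt.hasMFDerivAt
  have heq : ψ ∘ chartMul n G x =ᶠ[𝓝 p] (fun y ↦ ψ x * y) ∘ ψ := by
    have hc : ContinuousAt ((fun y ↦ ψ x * y) ∘ ψ) p := h1.continuousAt
    have := hc.preimage_mem_nhds ((isOpen_extChartAt_source (I := 𝓡 n) (1 : G)).mem_nhds
      (by simpa [hψp] using hgx))
    filter_upwards [this] with y hy
    exact PartialEquiv.left_inv _ hy
  have h3 := hasMFDerivAt_unique h2 (h1.congr_of_eventuallyEq heq)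
  exact congr($h3 v)

theorem smulRight_one_map {E F : Type*} [NormedAddCommGroup E] [NormedSpace ℝ E]
    [NormedAddCommGroup F] [NormedSpace ℝ F] (L : E →L[ℝ] F) (w : E) :
    (1 : ℝ →L[ℝ] ℝ).smulRight (L w) = L ∘L (1 : ℝ →L[ℝ] ℝ).smulRight w :=
  ContinuousLinearMap.ext fun r ↦ (map_smul L r w).symm

/-- Since φ ∘ L_g = L_{φ(g)} ∘ φ, an automorphism sends the left-invariant field of v to that of its
differential applied to v. -/
theorem IsMIntegralCurveOn.map_mulAut {φ : MulAut G} (hφ : ContMDiff (𝓡 n) (𝓡 n) ∞ φ)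
    {v : GroupLieAlgebra (𝓡 n) G} {γ : ℝ → G} {s : Set ℝ}
    (hγ : IsMIntegralCurveOn γ (mulInvariantVectorField v) s) :
    IsMIntegralCurveOn (φ ∘ γ)
      (mulInvariantVectorField (differentialAtOne (n := n) φ v)) s := by
  intro t ht
  have hd := hφ.mdifferentiable (by simp)
  have hmul (g : G) := (contMDiff_mul_left (I := 𝓡 n) (n := ∞) (a := g)).mdifferentiable (by simp)
  have h := HasMFDerivAt.comp_hasMFDerivWithinAt t (hd (γ t)).hasMFDerivAt (hγ t ht)
  have h1 : ∀ y, y = γ t → HasMFDerivAt (𝓡 n) (𝓡 n) φ y (mfderiv (𝓡 n) (𝓡 n) φ (γ t)) := by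
    rintro _ rfl
    exact (hd _).hasMFDerivAt
  have h2 : ∀ y, y = (1 : G) → HasMFDerivAt (𝓡 n) (𝓡 n) (fun z ↦ φ (γ t) * z) y
      (mfderiv (𝓡 n) (𝓡 n) (fun z ↦ φ (γ t) * z) (1 : G)) := by
    rintro _ rfl
    exact (hmul _ _).hasMFDerivAt
  have h3 := HasMFDerivAt.comp 1 (h1 (γ t * 1) (mul_one _)) (hmul (γ t) 1).hasMFDerivAt
  have h4 := HasMFDerivAt.comp 1 (h2 (φ 1) (map_one φ)) (hd 1).hasMFDerivAt
  have h5 : φ ∘ (fun z ↦ γ t * z) = (fun z ↦ φ (γ t) * z) ∘ φ := by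
    ext z
    simp
  rw [h5] at h3
  have h6 := congr($(hasMFDerivAt_unique h3 h4) v)
  have h7 : mulInvariantVectorField (I := 𝓡 n) (differentialAtOne (n := n) φ v) ((φ ∘ γ) t) =
      mfderiv (𝓡 n) (𝓡 n) φ (γ t) (mulInvariantVectorField v (γ t)) := h6.symm
  rw [h7]
  exact h.congr_mfderiv (smulRight_one_map (E := EuclideanSpace ℝ (Fin n))
    (F := EuclideanSpace ℝ (Fin n)) (mfderiv (𝓡 n) (𝓡 n) φ (γ t)) _).symm

end LocalExponential

/-! ### The local exponential map. -/

section LocalExponential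

open Set Filter Metric
open scoped Topology NNReal

variable {n : ℕ} {G : Type*} [TopologicalSpace G] [ChartedSpace (EuclideanSpace ℝ (Fin n)) G]
  [Group G]

/-- The properties of the exponential map of `G`, restricted to the ball of radius `r`, that are
needed here. -/
structure IsLocalExp (e : EuclideanSpace ℝ (Fin n) → G) (r : ℝ) : Prop where
  pos : 0 < r
  apply_zero : e 0 = 1
  continuousAt : ContinuousAt e 0
  hasStrictFDerivAt : HasStrictFDerivAt (fun v ↦ extChartAt (𝓡 n) (1 : G) (e v))
    (ContinuousLinearMap.id ℝ (EuclideanSpace ℝ (Fin n))) 0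
  map_mulAut : ∀ φ : MulAut G, ContMDiff (𝓡 n) (𝓡 n) ∞ φ → ∀ v w : EuclideanSpace ℝ (Fin n),
    differentialAtOne (n := n) φ v = w → ‖v‖ < r → ‖w‖ < r → φ (e v) = e w

variable [LieGroup (𝓡 n) ∞ G]

theorem isMIntegralCurveOn_extChartAt_symm {c : ℝ → EuclideanSpace ℝ (Fin n)} {s : Set ℝ}
    {v : EuclideanSpace ℝ (Fin n)} (ht : ∀ t, c t ∈ (extChartAt (𝓡 n) (1 : G)).target)
    (hd : ∀ t ∈ s, HasDerivAt c (chartInvariantField n G (c t) v) t) :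
    IsMIntegralCurveOn (fun t ↦ (extChartAt (𝓡 n) (1 : G)).symm (c t))
      (mulInvariantVectorField (I := 𝓡 n) (G := G) v) s := by
  intro t hts
  have h := HasMFDerivAt.comp t (mdifferentiableAt_extChartAt_symm (ht t)).hasMFDerivAt
    (hd t hts).hasFDerivAt.hasMFDerivAt
  rw [← mfderiv_extChartAt_symm_chartInvariantField (ht t)]
  exact h.hasMFDerivWithinAt.congr_mfderiv (smulRight_one_map (E := EuclideanSpace ℝ (Fin n))
    (F := EuclideanSpace ℝ (Fin n))
    (mfderiv (𝓡 n) (𝓡 n) (extChartAt (𝓡 n) (1 : G)).symm (c t)) _).symm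

theorem exists_isLocalExp [T2Space G] :
    ∃ (e : EuclideanSpace ℝ (Fin n) → G) (r : ℝ), IsLocalExp e r := by
  set p := extChartAt (𝓡 n) (1 : G) 1 with hp
  set ψ := (extChartAt (𝓡 n) (1 : G)).symm with hψ
  set Y := chartInvariantField n G with hY
  have hYp : Y p = ContinuousLinearMap.id ℝ _ := chartInvariantField_one
  have hYd : ContDiffAt ℝ 1 Y p := contDiffAt_chartInvariantField
  obtain ⟨K, s, hs, hKs⟩ := hYd.exists_lipschitzOnWith
  have hY2 : ∀ᶠ x in 𝓝 p, ‖Y x‖ < 2 := by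
    refine hYd.continuousAt.norm.eventually_lt_const ?_
    change ‖Y p‖ < 2
    rw [hYp]
    exact ContinuousLinearMap.norm_id_le.trans_lt one_lt_two
  obtain ⟨R, hR, hsub⟩ := nhds_basis_closedBall.mem_iff.1
    (inter_mem (inter_mem hs hY2) (extChartAt_target_mem_nhds (I := 𝓡 n) (1 : G)))
  have hK : LipschitzOnWith K Y (closedBall p R) := hKs.mono fun x hx ↦ (hsub hx).1.1
  have h2 : ∀ x ∈ closedBall p R, ‖Y x‖ ≤ 2 := fun x hx ↦ (hsub hx).1.2.le
  choose! c hc using fun (v : EuclideanSpace ℝ (Fin n)) (hv : 4 * ‖v‖ ≤ R) ↦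
    exists_isShortSolution hK h2 hv
  have hct {v} (hv : 4 * ‖v‖ ≤ R) (t : ℝ) : c v t ∈ (extChartAt (𝓡 n) (1 : G)).target :=
    (hsub (closedBall_subset_closedBall hv ((hc v hv).mem_closedBall t))).2
  have h0 : c 0 1 = p := by
    simpa using (hc 0 (by simpa using hR.le)).mem_closedBall 1
  have hstrict := hasStrictFDerivAt_isShortSolution hR hK h2 hYp hc
  have hcurve {v} (hv : 4 * ‖v‖ ≤ R) : IsMIntegralCurveOn (fun t ↦ ψ (c v t))
      (mulInvariantVectorField (I := 𝓡 n) (G := G) v) (Ioo (-2) 2) :=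
    isMIntegralCurveOn_extChartAt_symm (hct hv) (hc v hv).hasDerivAt
  refine ⟨fun v ↦ ψ (c v 1), R / 4, by positivity, ?_, ?_, ?_, ?_⟩
  · rw [h0]
    exact extChartAt_to_inv 1
  · refine ContinuousAt.comp (g := ψ) (f := fun v ↦ c v 1) ?_ hstrict.continuousAt
    rw [h0]
    exact continuousAt_extChartAt_symm (1 : G)
  · refine hstrict.congr_of_eventuallyEq ?_
    filter_upwards [closedBall_mem_nhds (0 : EuclideanSpace ℝ (Fin n)) (by positivity : 0 < R / 4)]
      with v hv
    rw [mem_closedBall_zero_iff] at hv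
    exact (PartialEquiv.right_inv _ (hct (by linarith) 1)).symm
  · rintro φ hφ v w rfl hv hw
    have hv' : 4 * ‖v‖ ≤ R := by linarith
    have hw' := hcurve (v := differentialAtOne (n := n) φ v) (by linarith)
    have hvf : ContMDiff (𝓡 n) ((𝓡 n).prod (𝓡 n)) 1
        (fun g : G ↦ (mulInvariantVectorField (I := 𝓡 n) (differentialAtOne (n := n) φ v) g :
          TangentBundle (𝓡 n) G)) := by
      refine (contMDiff_mulInvariantVectorField _).of_le ?_
      rw [minSmoothness_of_isRCLikeNormedField]
      norm_num
    -- The image under φ of the curve of v and the curve of dφ(v) are integral curves of one field,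
    -- both through 1 at time 0, so they agree at time 1.
    refine isMIntegralCurveOn_Ioo_eqOn_of_contMDiff_boundaryless (t₀ := 0) (by norm_num) hvf
      ((hcurve hv').map_mulAut hφ) hw' ?_ (by norm_num : (1 : ℝ) ∈ Ioo (-2 : ℝ) 2)
    have hz : ψ p = 1 := extChartAt_to_inv 1
    simp [(hc v hv').apply_zero, (hc (differentialAtOne (n := n) φ v)
      (by linarith)).apply_zero, hz]

end LocalExponential

/-! ### Local surjectivity of s ↦ Φ(ε w(s)) with w(0) possibly nonzero. -/

section ScaledMaps

open Set Filter Metric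
open scoped Topology NNReal Pointwise

variable {E V : Type*} [NormedAddCommGroup E] [NormedSpace ℝ E] [CompleteSpace E]
  [NormedAddCommGroup V] [NormedSpace ℝ V]

/-- If `w` is a map to `V` and `T ∘ w` is a submersion at `0`, then so is `Φ (ε • w ·)` for small
`ε`, when `Φ` has strict derivative `T` at `0`. -/
theorem exists_image_smul_mem_nhds {Φ : V → E} {T : V →L[ℝ] E} (hΦ : HasStrictFDerivAt Φ T 0)
    {w : E → V} {w' : E →L[ℝ] V} (hw : HasStrictFDerivAt w w' 0) (B : E ≃L[ℝ] E)
    (hB : T ∘L w' = B) {U : Set V} (hU : U ∈ 𝓝 0) :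
    ∃ ε : ℝ, 0 < ε ∧ ∃ ρ : ℝ, 0 < ρ ∧ (∀ s ∈ ball (0 : E) ρ, ε • w s ∈ U) ∧
      (fun s ↦ Φ (ε • w s)) '' ball 0 ρ ∈ 𝓝 (Φ (ε • w 0)) := by
  -- The error is c from linearising T ∘ w plus c from replacing Φ by T; the sum must stay below the
  -- surjectivity threshold of B.
  obtain ⟨c, hc, hcB⟩ : ∃ c : ℝ≥0, 0 < c ∧
      (Subsingleton E ∨ c + c < B.toNonlinearRightInverse.nnnorm⁻¹) := by
    rcases subsingleton_or_nontrivial E with hE | hE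
    · exact ⟨1, one_pos, .inl hE⟩
    · have hpos : 0 < B.toNonlinearRightInverse.nnnorm⁻¹ := inv_pos.2 B.nnnorm_symm_pos
      obtain ⟨c, hc, hlt⟩ := exists_between (half_pos hpos)
      exact ⟨c, hc, .inr (by simpa using add_lt_add hlt hlt)⟩
  obtain ⟨Kw, S₁, hS₁, hKw⟩ := hw.exists_lipschitzOnWith
  have hTw : HasStrictFDerivAt (fun s ↦ T (w s)) (B : E →L[ℝ] E) 0 := by
    rw [← hB]
    exact T.hasStrictFDerivAt.comp 0 hw
  obtain ⟨S₂, hS₂, happ⟩ := hTw.approximates_deriv_on_nhds (.inr hc)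
  obtain ⟨S₃, hS₃, hΦapp⟩ := hΦ.approximates_deriv_on_nhds (c := c / (Kw + 1))
    (.inr (by positivity))
  obtain ⟨ρ, hρ, hρS⟩ := nhds_basis_ball.mem_iff.1 (inter_mem hS₁ hS₂)
  obtain ⟨δ, hδ, hδS⟩ := nhds_basis_ball.mem_iff.1 (inter_mem hS₃ hU)
  set M := ‖w 0‖ + Kw * ρ with hM
  have hM0 : 0 ≤ M := by positivity
  have hwM (s : E) (hs : s ∈ ball 0 ρ) : ‖w s‖ ≤ M := by
    have h1 := hKw.norm_sub_le (hρS hs).1 (hρS (mem_ball_self hρ)).1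
    have h2 : ‖s - 0‖ ≤ ρ := (mem_ball_iff_norm.1 hs).le
    calc ‖w s‖ ≤ ‖w 0‖ + ‖w s - w 0‖ := by
          rw [add_comm]; exact norm_le_norm_sub_add _ _
      _ ≤ ‖w 0‖ + Kw * ρ := by
          gcongr
          exact h1.trans (by gcongr)
  -- After ρ is fixed, ε shrinks the bounded set w(ball) into the region where Φ is close to T.
  set ε := δ / (M + 1) with hε
  have hε0 : 0 < ε := by positivity
  have hmem (s : E) (hs : s ∈ ball 0 ρ) : ε • w s ∈ S₃ ∩ U := by
    refine hδS (mem_ball_zero_iff.2 ?_)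
    rw [norm_smul, Real.norm_of_nonneg hε0.le]
    calc ε * ‖w s‖ ≤ ε * M := by gcongr; exact hwM s hs
      _ < ε * (M + 1) := by gcongr; linarith
      _ = δ := by rw [hε]; field_simp
  refine ⟨ε, hε0, ρ, hρ, fun s hs ↦ (hmem s hs).2, ?_⟩
  -- Dividing by ε makes the estimate scale-free. The tolerance c/(Kw + 1) for Φ compensates for the
  -- Lipschitz constant of w.
  have hg : ApproximatesLinearOn (fun s ↦ ε⁻¹ • Φ (ε • w s)) (B : E →L[ℝ] E) (ball 0 ρ)
      (c + c) := by
    intro x hx y hy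
    have h1 := hΦapp _ (hmem x hx).1 _ (hmem y hy).1
    have h2 := happ x (hρS hx).2 y (hρS hy).2
    have h3 := hKw.norm_sub_le (hρS hx).1 (hρS hy).1
    have h4 : ε⁻¹ • Φ (ε • w x) - ε⁻¹ • Φ (ε • w y) - B (x - y) =
        ε⁻¹ • (Φ (ε • w x) - Φ (ε • w y) - T (ε • w x - ε • w y))
          + (T (w x) - T (w y) - B (x - y)) := by
      simp only [map_sub, map_smul, smul_sub, inv_smul_smul₀ hε0.ne']
      abel
    have h5 : ‖ε⁻¹ • (Φ (ε • w x) - Φ (ε • w y) - T (ε • w x - ε • w y))‖ ≤ c * ‖x - y‖ := by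
      rw [norm_smul, norm_inv, Real.norm_of_nonneg hε0.le]
      rw [← smul_sub ε (w x), norm_smul, Real.norm_of_nonneg hε0.le, smul_sub] at h1
      calc _ ≤ ε⁻¹ * ((c / (Kw + 1) : ℝ≥0) * (ε * ‖w x - w y‖)) := by gcongr
        _ = (c / (Kw + 1) : ℝ≥0) * ‖w x - w y‖ := by field_simp
        _ ≤ (c / (Kw + 1) : ℝ≥0) * (Kw * ‖x - y‖) := by gcongr
        _ = c * (Kw / (Kw + 1)) * ‖x - y‖ := by push_cast; ring
        _ ≤ c * 1 * ‖x - y‖ := by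
          gcongr
          rw [div_le_one (by positivity)]
          linarith
        _ = c * ‖x - y‖ := by ring
    change ‖ε⁻¹ • Φ (ε • w x) - ε⁻¹ • Φ (ε • w y) - B (x - y)‖ ≤ _
    rw [h4]
    refine (norm_add_le _ _).trans ((add_le_add h5 h2).trans (le_of_eq ?_))
    push_cast
    ring
  have h := hg.image_mem_nhds B.toNonlinearRightInverse (ball_mem_nhds 0 hρ) hcB
  rw [← smul_mem_nhds_smul_iff₀ hε0.ne', smul_inv_smul₀ hε0.ne'] at h
  convert h using 1
  rw [← image_smul, image_image]
  simp only [smul_inv_smul₀ hε0.ne']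

end ScaledMaps

/-! ### Strict derivatives at 1 of products of group-valued maps. -/

section GroupValuedMaps

open Set Filter Metric
open scoped Topology

variable {n : ℕ} {G : Type*} [TopologicalSpace G] [ChartedSpace (EuclideanSpace ℝ (Fin n)) G]
  [Group G] {V : Type*} [NormedAddCommGroup V] [NormedSpace ℝ V]

/-- The map `F` sends `0` to `1`, is continuous there, and its strict derivative there is `T`. -/
structure HasStrictDerivAtOne (F : V → G) (T : V →L[ℝ] EuclideanSpace ℝ (Fin n)) : Prop where
  apply_zero : F 0 = 1
  continuousAt : ContinuousAt F 0
  hasStrictFDerivAt : HasStrictFDerivAt (fun v ↦ extChartAt (𝓡 n) (1 : G) (F v)) T 0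

theorem HasStrictDerivAtOne.eventually_mem_source {F : V → G}
    {T : V →L[ℝ] EuclideanSpace ℝ (Fin n)} (hF : HasStrictDerivAtOne F T) :
    ∀ᶠ v in 𝓝 0, F v ∈ (extChartAt (𝓡 n) (1 : G)).source := by
  refine hF.continuousAt.eventually ?_
  rw [hF.apply_zero]
  exact extChartAt_source_mem_nhds 1

theorem HasStrictDerivAtOne.one : HasStrictDerivAtOne (fun _ : V ↦ (1 : G))
    (0 : V →L[ℝ] EuclideanSpace ℝ (Fin n)) :=
  ⟨rfl, continuousAt_const, hasStrictFDerivAt_const _ _⟩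

theorem IsLocalExp.hasStrictDerivAtOne_comp {e : EuclideanSpace ℝ (Fin n) → G} {r : ℝ}
    (he : IsLocalExp e r) (L : V →L[ℝ] EuclideanSpace ℝ (Fin n)) :
    HasStrictDerivAtOne (fun v ↦ e (L v)) L where
  apply_zero := by rw [map_zero, he.apply_zero]
  continuousAt := by
    refine ContinuousAt.comp (g := e) ?_ L.continuous.continuousAt
    rw [map_zero]
    exact he.continuousAt
  hasStrictFDerivAt := by
    refine (HasStrictFDerivAt.comp (g := fun v ↦ extChartAt (𝓡 n) (1 : G) (e v)) (0 : V) ?_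
      L.hasStrictFDerivAt : HasStrictFDerivAt _ (ContinuousLinearMap.id ℝ _ ∘L L) 0)
    rw [map_zero]
    exact he.hasStrictFDerivAt

variable [LieGroup (𝓡 n) ∞ G]

theorem HasStrictDerivAtOne.mul {F F' : V → G} {T T' : V →L[ℝ] EuclideanSpace ℝ (Fin n)}
    (hF : HasStrictDerivAtOne F T) (hF' : HasStrictDerivAtOne F' T') :
    HasStrictDerivAtOne (fun v ↦ F v * F' v) (T + T') where
  apply_zero := by rw [hF.apply_zero, hF'.apply_zero, one_mul]
  continuousAt := by
    have := topologicalGroup_of_lieGroup (𝓡 n) ∞ (G := G)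
    exact hF.continuousAt.mul hF'.continuousAt
  hasStrictFDerivAt := by
    have h : HasStrictFDerivAt (Function.uncurry (chartMul n G))
        (ContinuousLinearMap.fst ℝ _ _ + ContinuousLinearMap.snd ℝ _ _)
        (extChartAt (𝓡 n) (1 : G) (F 0), extChartAt (𝓡 n) (1 : G) (F' 0)) := by
      rw [hF.apply_zero, hF'.apply_zero]
      exact hasStrictFDerivAt_chartMul
    have h2 := h.comp 0 (hF.hasStrictFDerivAt.prodMk hF'.hasStrictFDerivAt)
    refine (h2.congr_of_eventuallyEq ?_).congr_fderiv (by ext v; simp)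
    filter_upwards [hF.eventually_mem_source, hF'.eventually_mem_source] with v hv hv'
    simp only [Function.uncurry_apply_pair, chartMul]
    rw [PartialEquiv.left_inv _ hv, PartialEquiv.left_inv _ hv']

theorem HasStrictDerivAtOne.list_prod {ι : Type*} {F : ι → V → G}
    {T : ι → V →L[ℝ] EuclideanSpace ℝ (Fin n)} (hF : ∀ i, HasStrictDerivAtOne (F i) (T i))
    (l : List ι) : HasStrictDerivAtOne (fun v ↦ (l.map fun i ↦ F i v).prod) (l.map T).sum := by
  induction l with
  | nil => simpa using HasStrictDerivAtOne.one
  | cons i l ih => simpa using (hF i).mul ih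

end GroupValuedMaps

/-! ### The linear flow exp(tB) and its bounded orbits. -/

section LinearFlow

open Set Filter
open scoped Topology

variable {E : Type*} [NormedAddCommGroup E] [NormedSpace ℝ E]

theorem exp_zero_smul_apply (B : E →L[ℝ] E) (v : E) : NormedSpace.exp ((0 : ℝ) • B) v = v := by
  simp

theorem exp_smul_apply_eq_of_hasDerivAt [CompleteSpace E] (B : E →L[ℝ] E) {u : ℝ → E}
    (hu : ∀ t, HasDerivAt u (B (u t)) t) (t : ℝ) : NormedSpace.exp (t • B) (u 0) = u t := by
  have hexp (t : ℝ) : HasDerivAt (fun t : ℝ ↦ NormedSpace.exp (t • B) (u 0))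
      (B (NormedSpace.exp (t • B) (u 0))) t :=
    (ContinuousLinearMap.apply ℝ E (u 0)).hasFDerivAt.comp_hasDerivAt t
      (hasDerivAt_exp_smul_const' B t)
  exact congr_fun (ODE_solution_unique_univ (v := fun _ ↦ B) (s := fun _ ↦ univ) (K := ‖B‖₊)
    (t₀ := 0)    (fun _ ↦ B.lipschitz.lipschitzOnWith) (fun t ↦ ⟨hexp t, mem_univ _⟩)
    (fun t ↦ ⟨hu t, mem_univ _⟩) (by simp)) t

theorem hasStrictFDerivAt_exp_smul_proj {ι : Type*} [Fintype ι] [CompleteSpace E]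
    (B : E →L[ℝ] E) (π : ι → E →L[ℝ] ℝ) (b : ι → E) :
    HasStrictFDerivAt (fun (s : E) i ↦ NormedSpace.exp (π i s • B) (b i))
      (ContinuousLinearMap.pi fun i ↦ (π i).smulRight (B (b i))) 0 := by
  refine hasStrictFDerivAt_pi.2 fun i ↦ ?_
  have h1 : HasStrictDerivAt (fun t : ℝ ↦ NormedSpace.exp (t • B)) B (π i 0) := by
    simpa using hasStrictDerivAt_exp_smul_const (𝕂 := ℝ) B (π i 0)
  have h2 := h1.hasStrictFDerivAt.comp 0 (π i).hasStrictFDerivAt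
  have h3 := ((ContinuousLinearMap.apply ℝ E (b i)).hasStrictFDerivAt).comp 0 h2
  refine h3.congr_fderiv ?_
  ext s
  simp

/-- If a real linear map has a complex eigenvalue with nonpositive real part, then some nonzero
orbit of its flow is bounded in positive time. -/
theorem exists_bounded_orbit [CompleteSpace E] (B : E →L[ℝ] E) {z : ℂ} (hz : z.re ≤ 0)
    (h : Module.End.HasEigenvalue (LinearMap.baseChange ℂ (B : E →ₗ[ℝ] E)) z) :
    ∃ v : E, v ≠ 0 ∧ ∃ M : ℝ, ∀ t : ℝ, 0 ≤ t → ‖NormedSpace.exp (t • B) v‖ ≤ M := by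
  obtain ⟨ξ, hξ⟩ := h.exists_hasEigenvector
  set R : ℂ ⊗[ℝ] E →ₗ[ℝ] E := TensorProduct.lid ℝ E ∘ₗ Complex.reLm.rTensor E with hR
  set J : ℂ ⊗[ℝ] E →ₗ[ℝ] E := TensorProduct.lid ℝ E ∘ₗ Complex.imLm.rTensor E with hJ
  have hRt (w : ℂ) (x : E) : R (w ⊗ₜ x) = w.re • x := by simp [hR]
  have hJt (w : ℂ) (x : E) : J (w ⊗ₜ x) = w.im • x := by simp [hJ]
  have hdec (η : ℂ ⊗[ℝ] E) : η = (1 : ℂ) ⊗ₜ R η + Complex.I ⊗ₜ J η := by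
    induction η with
    | zero => simp
    | add x y hx hy =>
      nth_rw 1 [hx, hy]
      simp only [map_add, TensorProduct.tmul_add]
      abel
    | tmul w x =>
      rw [hRt, hJt, ← TensorProduct.smul_tmul, ← TensorProduct.smul_tmul, ← TensorProduct.add_tmul]
      congr 1
      apply Complex.ext <;> simp
  have hRB (η : ℂ ⊗[ℝ] E) : R (LinearMap.baseChange ℂ (B : E →ₗ[ℝ] E) η) = B (R η) := by
    induction η with
    | zero => simp
    | add x y hx hy => simp only [map_add, hx, hy]
    | tmul w x => simp [hRt]
  have hJB (η : ℂ ⊗[ℝ] E) : J (LinearMap.baseChange ℂ (B : E →ₗ[ℝ] E) η) = B (J η) := by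
    induction η with
    | zero => simp
    | add x y hx hy => simp only [map_add, hx, hy]
    | tmul w x => simp [hJt]
  have hRz (η : ℂ ⊗[ℝ] E) : R (z • η) = z.re • R η - z.im • J η := by
    induction η with
    | zero => simp
    | add x y hx hy => simp only [smul_add, map_add, hx, hy]; abel
    | tmul w x => simp [TensorProduct.smul_tmul', hRt, hJt, sub_smul, mul_smul]
  have hJz (η : ℂ ⊗[ℝ] E) : J (z • η) = z.re • J η + z.im • R η := by
    induction η with
    | zero => simp
    | add x y hx hy => simp only [smul_add, map_add, hx, hy]; abel
    | tmul w x => simp [TensorProduct.smul_tmul', hRt, hJt, add_smul, mul_smul]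
  have h1 : B (R ξ) = z.re • R ξ - z.im • J ξ := by rw [← hRB, hξ.apply_eq_smul, hRz]
  have h2 : B (J ξ) = z.re • J ξ + z.im • R ξ := by rw [← hJB, hξ.apply_eq_smul, hJz]
  -- If the real part of the eigenvector vanishes, multiply the eigenvector by -i.
  obtain ⟨x, y, hx, hxB, hyB⟩ : ∃ x y : E, x ≠ 0 ∧ B x = z.re • x - z.im • y ∧
      B y = z.re • y + z.im • x := by
    by_cases h0 : R ξ = 0
    · refine ⟨J ξ, -R ξ, fun h0' ↦ hξ.2 ?_, by rw [h2]; simp, by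
        rw [map_neg, h1, smul_neg]; abel⟩
      rw [hdec ξ, h0, h0']
      simp
    · exact ⟨R ξ, J ξ, h0, h1, h2⟩
  -- This is the real part of e^{zt}(x + iy).
  set u : ℝ → E := fun t ↦ Real.exp (z.re * t) • (Real.cos (z.im * t) • x - Real.sin (z.im * t) • y)
    with hu
  have hder (t : ℝ) : HasDerivAt u (B (u t)) t := by
    have hl (a : ℝ) : HasDerivAt (fun t : ℝ ↦ a * t) a t := by
      simpa using (hasDerivAt_id t).const_mul a
    have hd := (hl z.re).exp.smul (((hl z.im).cos.smul_const x).sub ((hl z.im).sin.smul_const y))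
    refine hd.congr_deriv ?_
    simp only [hu, map_smul, map_sub, hxB, hyB, Pi.sub_apply]
    module
  have hu0 : u 0 = x := by simp [hu]
  refine ⟨x, hx, ‖x‖ + ‖y‖, fun t ht ↦ ?_⟩
  rw [← hu0, exp_smul_apply_eq_of_hasDerivAt B hder t, hu0]
  have he : Real.exp (z.re * t) ≤ 1 :=
    Real.exp_le_one_iff.2 (mul_nonpos_of_nonpos_of_nonneg hz ht)
  calc ‖u t‖ = Real.exp (z.re * t) * ‖Real.cos (z.im * t) • x - Real.sin (z.im * t) • y‖ := by
        rw [hu, norm_smul, Real.norm_of_nonneg (Real.exp_pos _).le]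
    _ ≤ 1 * (‖Real.cos (z.im * t) • x‖ + ‖Real.sin (z.im * t) • y‖) := by
        gcongr
        exact norm_sub_le _ _
    _ ≤ 1 * (1 * ‖x‖ + 1 * ‖y‖) := by
        rw [norm_smul, norm_smul]
        gcongr
        · exact Real.abs_cos_le_one _
        · exact Real.abs_sin_le_one _
    _ = ‖x‖ + ‖y‖ := by ring

end LinearFlow

/-! ### Boundedness near 1 and positivity of the spectrum. -/

section Dilations

open Set Filter Metric
open scoped Topology

variable {n : ℕ} {G : Type*} [TopologicalSpace G] [ChartedSpace (EuclideanSpace ℝ (Fin n)) G]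
  [Group G]

/-- A left-invariant distance with dilations `D t` that are given by `exp (t B)` in exponential
coordinates. -/
structure IsLinearlyDilated (d : G → G → ℝ) (D : ℝ → G →* G)
    (B : EuclideanSpace ℝ (Fin n) →L[ℝ] EuclideanSpace ℝ (Fin n))
    (e : EuclideanSpace ℝ (Fin n) → G) (r : ℝ) : Prop where
  isDistance : IsDistance d
  left_invariant : ∀ g x y, d (g * x) (g * y) = d x y
  dilation : ∀ t x y, d (D t x) (D t y) = Real.exp t * d x y
  isLocalExp : IsLocalExp e r
  map_exp : ∀ t v, ‖v‖ < r → ‖NormedSpace.exp (t • B) v‖ < r →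
    D t (e v) = e (NormedSpace.exp (t • B) v)

theorem IsLocalExp.eventually_ne_one {e : EuclideanSpace ℝ (Fin n) → G} {r : ℝ}
    (he : IsLocalExp e r) : ∀ᶠ v in 𝓝[≠] 0, e v ≠ 1 := by
  have := he.hasStrictFDerivAt.hasFDerivAt.eventually_ne (c := extChartAt (𝓡 n) (1 : G) 1)
    ⟨1, fun z ↦ by simp⟩
  filter_upwards [this] with v hv h
  exact hv (by rw [h])

namespace IsLinearlyDilated

variable {d : G → G → ℝ} {D : ℝ → G →* G}
  {B : EuclideanSpace ℝ (Fin n) →L[ℝ] EuclideanSpace ℝ (Fin n)}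
  {e : EuclideanSpace ℝ (Fin n) → G} {r : ℝ}

theorem norm_map (h : IsLinearlyDilated d D B e r) (t : ℝ) (x : G) :
    d 1 (D t x) = Real.exp t * d 1 x := by
  rw [← h.dilation, map_one]

theorem norm_mul_le (h : IsLinearlyDilated d D B e r) (x y : G) :
    d 1 (x * y) ≤ d 1 x + d 1 y := by
  have := h.isDistance.triangle 1 x (x * y)
  rwa [show d x (x * y) = d 1 y by rw [← h.left_invariant x 1 y, mul_one]] at this

theorem norm_list_prod_le (h : IsLinearlyDilated d D B e r) (l : List G) :
    d 1 l.prod ≤ (l.map (d 1)).sum := by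
  induction l with
  | nil => simp [(h.isDistance.eq_zero_iff 1 1).2 rfl]
  | cons x l ih =>
    simp only [List.prod_cons, List.map_cons, List.sum_cons]
    exact (h.norm_mul_le _ _).trans (by gcongr)

/-- A nonzero orbit of `exp (t B)` that is bounded in positive time cannot be bounded for `d`, even
after it is scaled down. -/
theorem not_eventually_bounded (h : IsLinearlyDilated d D B e r) {v : EuclideanSpace ℝ (Fin n)}
    (hv : v ≠ 0) {M : ℝ} (hM : ∀ t : ℝ, 0 ≤ t → ‖NormedSpace.exp (t • B) v‖ ≤ M)
    (hC : ∀ᶠ ε in 𝓝[>] (0 : ℝ), ∃ C, ∀ t : ℝ, 0 ≤ t → d 1 (e (ε • NormedSpace.exp (t • B) v)) ≤ C) :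
    False := by
  have hM0 : 0 ≤ M := (norm_nonneg _).trans (hM 0 le_rfl)
  have hsmall : ∀ᶠ ε in 𝓝[>] (0 : ℝ), ε * M < r := by
    have : Tendsto (fun ε : ℝ ↦ ε * M) (𝓝[>] 0) (𝓝 (0 * M)) :=
      ((continuous_id.mul continuous_const).tendsto 0).mono_left nhdsWithin_le_nhds
    exact this.eventually_lt_const (by simpa using h.isLocalExp.pos)
  have hne : ∀ᶠ ε in 𝓝[>] (0 : ℝ), e (ε • v) ≠ 1 := by
    have : Tendsto (fun ε : ℝ ↦ ε • v) (𝓝[>] 0) (𝓝[≠] 0) := by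
      refine tendsto_nhdsWithin_iff.2 ⟨?_, ?_⟩
      · have h0 : Continuous fun ε : ℝ ↦ ε • v := by fun_prop
        simpa only [zero_smul] using (h0.tendsto 0).mono_left (nhdsWithin_le_nhds (s := Ioi 0))
      · filter_upwards [self_mem_nhdsWithin] with ε hε
        exact smul_ne_zero (ne_of_gt hε) hv
    exact this.eventually h.isLocalExp.eventually_ne_one
  have hpos : ∀ᶠ ε in 𝓝[>] (0 : ℝ), 0 < ε := self_mem_nhdsWithin
  -- One ε keeps the whole orbit within the domain of `map_exp` and makes its starting point
  -- different from 1, so that its norm grows like e^t.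
  obtain ⟨ε, ⟨C, hC⟩, hεM, hε1, hε⟩ := (hC.and (hsmall.and (hne.and hpos))).exists
  have horb (t : ℝ) (ht : 0 ≤ t) : ‖NormedSpace.exp (t • B) (ε • v)‖ < r := by
    rw [map_smul, norm_smul, Real.norm_of_nonneg hε.le]
    exact (mul_le_mul_of_nonneg_left (hM t ht) hε.le).trans_lt hεM
  have hεv : ‖ε • v‖ < r := by
    simpa only [exp_zero_smul_apply] using horb 0 le_rfl
  have hN : 0 < d 1 (e (ε • v)) :=
    (h.isDistance.nonneg _ _).lt_of_ne fun h0 ↦ hε1 ((h.isDistance.eq_zero_iff _ _).1 h0.symm).symm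
  obtain ⟨t, ht, ht0⟩ := (((Real.tendsto_exp_atTop.atTop_mul_const hN).eventually_gt_atTop C).and
    (eventually_ge_atTop 0)).exists
  rw [← h.norm_map, h.map_exp t _ hεv (horb t ht0), map_smul] at ht
  exact (ht.trans_le (hC t ht0)).false

theorem injective (h : IsLinearlyDilated d D B e r) : Function.Injective B := by
  refine (injective_iff_map_eq_zero B).2 fun v hv ↦ ?_
  by_contra hne
  have hfix (t : ℝ) : NormedSpace.exp (t • B) v = v :=
    exp_smul_apply_eq_of_hasDerivAt B (u := fun _ ↦ v)
      (fun t ↦ by simpa [hv] using hasDerivAt_const t v) t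
  exact h.not_eventually_bounded hne (M := ‖v‖) (fun t _ ↦ by rw [hfix])
    (Eventually.of_forall fun ε ↦ ⟨d 1 (e (ε • v)), fun t _ ↦ by rw [hfix]⟩)

variable [LieGroup (𝓡 n) ∞ G]

/-- Dilating n fixed points by s_i costs only a factor e^{s_i} in norm, and the products of the
results sweep out an open set because B is invertible. No continuity of d is involved. -/
theorem eventually_norm_le (h : IsLinearlyDilated d D B e r) : ∃ C, ∀ᶠ x in 𝓝 1, d 1 x ≤ C := by
  have := topologicalGroup_of_lieGroup (𝓡 n) ∞ (G := G)
  have he := h.isLocalExp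
  let b : Fin n → EuclideanSpace ℝ (Fin n) := fun i ↦ EuclideanSpace.single i 1
  let π : Fin n → EuclideanSpace ℝ (Fin n) →L[ℝ] ℝ := fun i ↦ EuclideanSpace.proj i
  let F : (Fin n → EuclideanSpace ℝ (Fin n)) → G :=
    fun v ↦ ((List.finRange n).map fun i ↦ e (v i)).prod
  have hF : HasStrictDerivAtOne F _ := HasStrictDerivAtOne.list_prod
    (fun i : Fin n ↦ he.hasStrictDerivAtOne_comp
      (ContinuousLinearMap.proj (R := ℝ) (φ := fun _ : Fin n ↦ EuclideanSpace ℝ (Fin n)) i))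
    (List.finRange n)
  have hw := hasStrictFDerivAt_exp_smul_proj B π b
  let B' : EuclideanSpace ℝ (Fin n) ≃L[ℝ] EuclideanSpace ℝ (Fin n) :=
    (LinearEquiv.ofInjectiveEndo (B : EuclideanSpace ℝ (Fin n) →ₗ[ℝ] EuclideanSpace ℝ (Fin n))
      h.injective).toContinuousLinearEquiv
  -- The derivative of s ↦ ∑ exp(s_i B) b_i at 0 is ∑ s_i B b_i = B s.
  have hB : ((List.finRange n).map fun i ↦ ContinuousLinearMap.proj (R := ℝ)
      (φ := fun _ : Fin n ↦ EuclideanSpace ℝ (Fin n)) i).sum ∘L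
      (ContinuousLinearMap.pi fun i ↦ (π i).smulRight (B (b i))) = B' := by
    rw [← List.ofFn_eq_map, List.sum_ofFn]
    refine ContinuousLinearMap.ext fun s ↦ ?_
    have hs : s = ∑ i, s i • b i := by
      ext j
      simp [b, Finset.sum_apply, Pi.single_apply]
    change _ = B s
    conv_rhs => rw [hs, map_sum]
    simp [π]
  have hU : {v : Fin n → EuclideanSpace ℝ (Fin n) |
      F v ∈ (extChartAt (𝓡 n) (1 : G)).source ∧ ∀ i, ‖v i‖ < r} ∈ 𝓝 0 := by
    refine hF.eventually_mem_source.and (eventually_all.2 fun i ↦ ?_)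
    have : Tendsto (fun v : Fin n → EuclideanSpace ℝ (Fin n) ↦ ‖v i‖) (𝓝 0) (𝓝 0) := by
      simpa using
        (continuous_apply (A := fun _ : Fin n ↦ EuclideanSpace ℝ (Fin n)) i).norm.tendsto 0
    exact this.eventually_lt_const he.pos
  obtain ⟨ε, hε, ρ, hρ, hρU, himg⟩ :=
    exists_image_smul_mem_nhds hF.hasStrictFDerivAt hw B' hB hU
  have h0 := hρU 0 (mem_ball_self hρ)
  set w : EuclideanSpace ℝ (Fin n) → Fin n → EuclideanSpace ℝ (Fin n) :=
    fun s i ↦ NormedSpace.exp (π i s • B) (b i) with hwdef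
  have hw0 (i : Fin n) : w 0 i = b i := by
    have : w 0 i = NormedSpace.exp ((0 : ℝ) • B) (b i) := by simp [hwdef]
    rw [this, exp_zero_smul_apply]
  set C : ℝ := ((List.finRange n).map fun i ↦ Real.exp ρ * d 1 (e (ε • b i))).sum with hC
  have hle (s : EuclideanSpace ℝ (Fin n)) (hs : s ∈ ball 0 ρ) : d 1 (F (ε • w s)) ≤ C := by
    refine (h.norm_list_prod_le _).trans ?_
    rw [List.map_map, hC]
    refine List.sum_le_sum fun i _ ↦ ?_
    have h1 : ‖ε • b i‖ < r := by simpa [hw0] using h0.2 i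
    have h2 : ‖NormedSpace.exp (π i s • B) (ε • b i)‖ < r := by
      simpa [hwdef] using (hρU s hs).2 i
    have h3 : (ε • w s) i = NormedSpace.exp (π i s • B) (ε • b i) := by simp [hwdef]
    simp only [Function.comp_apply]
    rw [h3, ← h.map_exp _ _ h1 h2, h.norm_map]
    have h4 : π i s ≤ ρ := by
      have h5 : ‖s i‖ ≤ ‖s‖ := PiLp.norm_apply_le s i
      exact (le_abs_self _).trans (h5.trans (mem_ball_zero_iff.1 hs).le)
    have := h.isDistance.nonneg 1 (e (ε • b i))
    gcongr
  set g₀ := F (ε • w 0) with hg₀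
  have hev : ∀ᶠ x in 𝓝 g₀, d 1 x ≤ C := by
    filter_upwards [(continuousAt_extChartAt' (I := 𝓡 n) h0.1).preimage_mem_nhds himg,
      extChartAt_source_mem_nhds' h0.1] with x hx hxs
    obtain ⟨s, hs, hsx⟩ := hx
    rw [← (extChartAt (𝓡 n) (1 : G)).injOn (hρU s hs).1 hxs hsx]
    exact hle s hs
  -- The bound holds near g₀, not near 1; left translation moves it at the cost of the constant
  -- N(g₀⁻¹).
  have hc : Tendsto (fun x ↦ g₀ * x) (𝓝 1) (𝓝 g₀) := by
    simpa using (continuous_const_mul g₀).tendsto 1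
  refine ⟨d 1 g₀⁻¹ + C, ?_⟩
  filter_upwards [hc.eventually hev] with x hx
  have := h.norm_mul_le g₀⁻¹ (g₀ * x)
  rw [inv_mul_cancel_left] at this
  linarith

theorem re_pos_of_hasEigenvalue (h : IsLinearlyDilated d D B e r) {z : ℂ}
    (hz : Module.End.HasEigenvalue (LinearMap.baseChange ℂ
      (B : EuclideanSpace ℝ (Fin n) →ₗ[ℝ] EuclideanSpace ℝ (Fin n))) z) : 0 < z.re := by
  by_contra! hre
  obtain ⟨v, hv, M, hM⟩ := exists_bounded_orbit B hre hz
  obtain ⟨C, hC⟩ := h.eventually_norm_le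
  have he : ∀ᶠ v in 𝓝 (0 : EuclideanSpace ℝ (Fin n)), d 1 (e v) ≤ C := by
    refine h.isLocalExp.continuousAt.eventually (p := fun x ↦ d 1 x ≤ C) ?_
    rwa [h.isLocalExp.apply_zero]
  obtain ⟨δ, hδ, hδC⟩ := Metric.eventually_nhds_iff_ball.1 he
  have hM0 : 0 ≤ M := (norm_nonneg _).trans (hM 0 le_rfl)
  refine h.not_eventually_bounded hv hM ?_
  have hsmall : ∀ᶠ ε in 𝓝[>] (0 : ℝ), ε * M < δ := by
    have : Tendsto (fun ε : ℝ ↦ ε * M) (𝓝[>] 0) (𝓝 (0 * M)) :=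
      ((continuous_id.mul continuous_const).tendsto 0).mono_left nhdsWithin_le_nhds
    exact this.eventually_lt_const (by simpa using hδ)
  filter_upwards [hsmall, self_mem_nhdsWithin] with ε hε hε0
  refine ⟨C, fun t ht ↦ hδC _ (mem_ball_zero_iff.2 ?_)⟩
  rw [norm_smul, Real.norm_of_nonneg (le_of_lt hε0)]
  exact (mul_le_mul_of_nonneg_left (hM t ht) (le_of_lt hε0)).trans_lt hε

end IsLinearlyDilated

end Dilations

end

/-! ### Conclusion, with the dilations in additive time. -/

theorem theorem1p1 {n : ℕ} {G : Type*} [TopologicalSpace G]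
    [ChartedSpace (EuclideanSpace ℝ (Fin n)) G] [Group G] [LieGroup (𝓡 n) ∞ G]
    (A : LieDerivation ℝ (GroupLieAlgebra (𝓡 n) G) (GroupLieAlgebra (𝓡 n) G))
    (d : G → G → ℝ) (hd : IsHomogeneousDistance A d) :
    InducesTopology d ∧ ConnectedSpace G ∧
      ∀ z : ℂ, Module.End.HasEigenvalue
        (LinearMap.baseChange ℂ
          (A : GroupLieAlgebra (𝓡 n) G →ₗ[ℝ] GroupLieAlgebra (𝓡 n) G)) z → 0 < z.re := by
  have := topologicalGroup_of_lieGroup (𝓡 n) ∞ (G := G)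
  have := ChartedSpace.locallyCompactSpace (EuclideanSpace ℝ (Fin n)) G
  have := ChartedSpace.t0Space (EuclideanSpace ℝ (Fin n)) G
  obtain ⟨δ, hδ, hδd⟩ := hd.exists_dilations
  obtain ⟨e, r, he⟩ := exists_isLocalExp (n := n) (G := G)
  let D : ℝ → G →* G := fun t ↦ (δ ⟨Real.exp t, Real.exp_pos t⟩).toMonoidHom
  let A' : EuclideanSpace ℝ (Fin n) →ₗ[ℝ] EuclideanSpace ℝ (Fin n) :=
    (A : GroupLieAlgebra (𝓡 n) G →ₗ[ℝ] GroupLieAlgebra (𝓡 n) G)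
  let B := LinearMap.toContinuousLinearMap A'
  have hL : IsLinearlyDilated d D B e r :=
    { isDistance := hd.isDistance
      left_invariant := hd.left_invariant
      dilation := fun t ↦ hδd ⟨Real.exp t, Real.exp_pos t⟩
      isLocalExp := he
      map_exp := fun t v hv hv' ↦ by
        refine he.map_mulAut _ (hδ.contMDiff _) v _ ?_ hv hv'
        rw [hδ.differential]
        -- With λ = e^t, λ^A is exp(tB); the rest is the identification of the tangent space at 1
        -- with ℝⁿ.
        simp only [rpowEnd, Real.log_exp]
        rfl }
  have hI : IsDilated d D :=
    { isDistance := hd.isDistance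
      left_invariant := hd.left_invariant
      apply_zero := fun x ↦ by
        have : (⟨Real.exp 0, Real.exp_pos 0⟩ : {r : ℝ // 0 < r}) = 1 := Subtype.ext Real.exp_zero
        change δ ⟨Real.exp 0, Real.exp_pos 0⟩ x = x
        rw [this, map_one, MulAut.one_apply]
      continuous_map := fun t ↦ (hδ.contMDiff _).continuous
      continuous_orbit := fun x ↦
        (hδ.continuous_orbit x).comp (Real.continuous_exp.subtype_mk Real.exp_pos)
      dilation := hL.dilation
      bounded := hL.eventually_norm_le }
  exact ⟨hI.inducesTopology, hI.connectedSpace, fun z hz ↦ hL.re_pos_of_hasEigenvalue hz⟩
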